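/- For every integer $t \ge 0$ and every $\varepsilon > 0$ there is a constant $C = C(t,\varepsilon) > 0$ such that the following holds for every finite field $\mathbb{F}_q$, every $d \ge 0$, every non-degenerate (not necessarily symmetric) bilinear form $B$ on $\mathbb{F}_q^d$ and every set $\mathcal{E} \subseteq \mathbb{F}_q \times \mathbb{F}_q^d$. For $\lambda = (\lambda_{ij})_{1 \le i < j \le t}$ with $\lambda_{ij} \in \mathbb{F}_q$, consider the system of $\binom{t}{2}$ equations \[ a_i + a_j + \lambda_{ij} = B(\mathbf{b}_i, \mathbf{b}_j), \qquad 1 \le i < j \le t, \] in the unknowns $(a_1, \mathbf{b}_1), \ldots, (a_t, \mathbf{b}_t) \in \mathcal{E}$ (not required to be distinct). (1) If $|\mathcal{E}| \ge C q^{\frac{d}{2} + t - 1}$, then for every $\lambda$ the number $N_\lambda$ of solutions of the system satisfies \[ \left| N_\lambda - \frac{|\mathcal{E}|^t}{q^{\binom{t}{2}}} \right| \le \varepsilon\, \frac{|\mathcal{E}|^t}{q^{\binom{t}{2}}}. \] (2) If $|\mathcal{E}| \ge C q^{\frac{d+t}{2}}$, then the system is solvable for at least $(1 - \varepsilon) q^{\binom{t}{2}}$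 of the $q^{\binom{t}{2}}$ choices of $\lambda$. In other words, $N_\lambda = (1 + o(1)) |\mathcal{E}|^t / q^{\binom{t}{2}}$ uniformly in $\lambda$ when $|\mathcal{E}| \gg q^{\frac{d}{2}+t-1}$, and the system is solvable for $(1 - o(1)) q^{\binom{t}{2}}$ choices of $\lambda$ when $|\mathcal{E}| \gg q^{\frac{d+t}{2}}$, where $X \gg Y$ means $Y = o(X)$. -/

import Mathlib

/-- The index set of the `t.choose 2` equations: pairs `i < j` of indices. -/
abbrev IndexPair (t : ℕ) : Type := {p : Fin t × Fin t // p.1 < p.2}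

/-- The solutions `((a₁, b₁), …, (a_t, b_t))`, with all `(a_i, b_i) ∈ E`, of the system
`a_i + a_j + lam_{ij} = B (b_i, b_j)`, `i < j`. -/
def sumProductSolutions {F : Type*} [Field F] {d t : ℕ}
    (B : LinearMap.BilinForm F (Fin d → F)) (E : Finset (F × (Fin d → F)))
    (lam : IndexPair t → F) : Set (Fin t → F × (Fin d → F)) :=
  {x | (∀ i, x i ∈ E) ∧
    ∀ p : IndexPair t,
      (x p.1.1).1 + (x p.1.2).1 + lam p = B (x p.1.1).2 (x p.1.2).2}

/-- The parameters `(lam_{ij})_{i < j}` for which the system has a solution in `E`. -/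
def solvableParameters {F : Type*} [Field F] {d : ℕ} (t : ℕ)
    (B : LinearMap.BilinForm F (Fin d → F)) (E : Finset (F × (Fin d → F))) :
    Set (IndexPair t → F) :=
  {lam | (sumProductSolutions B E lam).Nonempty}

/-!
Let `M c` be the `0`-`1` matrix on `F × V` of the relation `x.1 + y.1 + c = B x.2 y.2`.
Two rows of `M c` whose points differ in the `V`-coordinate have exactly `|V| / q` common ones,
because a nonzero functional `B (x.2 - y.2)` takes every value equally often. Hence, with `J` the
all-ones matrix and `A = M c - J / q`, the product `A * Aᵀ` is `|V|` times an orthogonal projection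
and `‖A‖ ≤ √|V|`: each equation is pseudorandom with density `1 / q`.

The number of solutions with all unknowns in `E` is a count of homomorphisms of the complete graph
on `t` vertices, whose edges carry such matrices restricted to `E`. Remove the edges one at a time.
Replacing the matrix `M` of the edge `{i, j}` by `J / q` changes the count by a bilinear form in
`A`, once the other coordinates are fixed; Cauchy–Schwarz over these coordinates bounds the change
by `‖A‖ / |E|` times the geometric mean of the counts for the graphs without the edges at `i` and
without the edges at `j`. These graphs have at most `t - 1` edges fewer, so by induction their
counts are larger by a factor of about `q ^ (t - 1)` at most, which the bound on `|E|` absorbs.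

For almost all parameters, it suffices by Cauchy–Schwarz to bound the number of pairs of tuples in
`E` with the same parameter. Subtracting the two systems turns these pairs into the solutions of
one system, for the form `B v.1 w.1 - B v.2 w.2` on `V × V` and points of `F × (V × V)` that
come from `E × E` with multiplicity at most `q`, which are counted in the same way.
-/

open Finset
open scoped Matrix Matrix.Norms.L2Operator

section OperatorNorm

variable {X Y : Type*} [Fintype X] [Fintype Y] [DecidableEq Y]

theorem abs_dotProduct_mulVec_le_l2_opNorm (A : Matrix Y Y ℝ) (g h : Y → ℝ) :
    |g ⬝ᵥ A *ᵥ h| ≤ ‖A‖ * (√(∑ y, g y ^ 2) * √(∑ y, h y ^ 2)) := by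
  have hinner := Matrix.inner_toEuclideanCLM A (WithLp.toLp 2 g) (WithLp.toLp 2 h)
  have hnorm (k : Y → ℝ) : ‖WithLp.toLp 2 k‖ = √(∑ y, k y ^ 2) := by
    simp only [EuclideanSpace.norm_eq, Real.norm_eq_abs, sq_abs]
  rw [← hinner, ← hnorm, ← hnorm, ← Matrix.l2_opNorm_toEuclideanCLM]
  calc _ ≤ ‖WithLp.toLp 2 g‖ * ‖Matrix.toEuclideanCLM (𝕜 := ℝ) A (WithLp.toLp 2 h)‖ :=
        abs_real_inner_le_norm _ _
    _ ≤ ‖WithLp.toLp 2 g‖ * (‖Matrix.toEuclideanCLM (𝕜 := ℝ) A‖ * ‖WithLp.toLp 2 h‖) := by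
        gcongr
        exact ContinuousLinearMap.le_opNorm _ _
    _ = _ := by ring

theorem abs_dotProduct_mulVec_le_of_mem_Icc (A : Matrix Y Y ℝ) {g h : Y → ℝ}
    (hg : ∀ y, g y ∈ Set.Icc 0 1) (hh : ∀ y, h y ∈ Set.Icc 0 1) :
    |g ⬝ᵥ A *ᵥ h| ≤ ‖A‖ * (√(∑ y, g y) * √(∑ y, h y)) := by
  refine (abs_dotProduct_mulVec_le_l2_opNorm A g h).trans ?_
  gcongr with y _ y _
  · exact pow_le_of_le_one (hg y).1 (hg y).2 two_ne_zero
  · exact pow_le_of_le_one (hh y).1 (hh y).2 two_ne_zero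

theorem abs_mul_dotProduct_mulVec_le_of_mem_Icc (A : Matrix Y Y ℝ) {c : ℝ} {g h : Y → ℝ}
    (hc : 0 ≤ c) (hg : ∀ y, g y ∈ Set.Icc 0 1) (hh : ∀ y, h y ∈ Set.Icc 0 1) :
    |c * (g ⬝ᵥ A *ᵥ h)| ≤ ‖A‖ * (√(c * ∑ y, g y) * √(c * ∑ y, h y)) := by
  rw [abs_mul, abs_of_nonneg hc, Real.sqrt_mul hc, Real.sqrt_mul hc]
  calc c * |g ⬝ᵥ A *ᵥ h| ≤ c * (‖A‖ * (√(∑ y, g y) * √(∑ y, h y))) := by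
        gcongr
        exact abs_dotProduct_mulVec_le_of_mem_Icc A hg hh
    _ = (√c * √c) * (‖A‖ * (√(∑ y, g y) * √(∑ y, h y))) := by rw [Real.mul_self_sqrt hc]
    _ = _ := by ring

theorem sq_l2_opNorm_one_submatrix_le (φ : X → Y) {r : ℕ} (hr : ∀ y, #{x | φ x = y} ≤ r) :
    ‖(1 : Matrix Y Y ℝ).submatrix φ id‖ ^ 2 ≤ r := by
  have hdiag : ((1 : Matrix Y Y ℝ).submatrix φ id)ᴴ * (1 : Matrix Y Y ℝ).submatrix φ id =
      Matrix.diagonal fun y => (#{x | φ x = y} : ℝ) := by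
    ext y y'
    simp only [Matrix.mul_apply, Matrix.conjTranspose_apply, Matrix.submatrix_apply, id,
      Matrix.one_apply, star_trivial, Matrix.diagonal_apply, mul_boole, ← ite_and]
    rw [sum_boole]
    split_ifs with h
    · simp [h]
    · simp only [Nat.cast_eq_zero, card_eq_zero, filter_eq_empty_iff]
      rintro x - ⟨rfl, rfl⟩
      exact h rfl
  rw [sq, ← Matrix.l2_opNorm_conjTranspose_mul_self, hdiag, Matrix.l2_opNorm_diagonal,
    pi_norm_le_iff_of_nonneg (by positivity)]
  intro y
  rw [Real.norm_natCast]
  exact_mod_cast hr y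

theorem l2_opNorm_submatrix_le [DecidableEq X] (A : Matrix Y Y ℝ) (φ : X → Y) {r : ℕ}
    (hr : ∀ y, #{x | φ x = y} ≤ r) : ‖A.submatrix φ φ‖ ≤ r * ‖A‖ := by
  set P : Matrix X Y ℝ := (1 : Matrix Y Y ℝ).submatrix φ id with hP
  have hfactor : A.submatrix φ φ = P * A * Pᴴ := by
    ext x x'
    simp [hP, Matrix.mul_apply, Matrix.one_apply]
  calc ‖A.submatrix φ φ‖ ≤ ‖P‖ * ‖A‖ * ‖Pᴴ‖ := by
        rw [hfactor]
        exact (Matrix.l2_opNorm_mul _ _).trans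
          (mul_le_mul_of_nonneg_right (Matrix.l2_opNorm_mul _ _) (norm_nonneg _))
    _ = ‖P‖ ^ 2 * ‖A‖ := by rw [Matrix.l2_opNorm_conjTranspose]; ring
    _ ≤ r * ‖A‖ := by
        gcongr
        exact sq_l2_opNorm_one_submatrix_le φ hr

end OperatorNorm

section Fibers

variable {F V : Type*} [Field F] [Fintype F] [DecidableEq F] [AddCommGroup V] [Module F V]
  [Fintype V]

theorem card_fiber_mul_card_of_ne_zero {φ : V →ₗ[F] F} (hφ : φ ≠ 0) (a : F) :
    #{v | φ v = a} * Fintype.card F = Fintype.card V := by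
  have hsurj : Function.Surjective φ := LinearMap.surjective hφ
  calc #{v | φ v = a} * Fintype.card F = ∑ a', #{v | φ v = a'} := by
        rw [sum_congr rfl fun a' _ =>
          AddMonoidHom.card_fiber_eq_of_mem_range φ (hsurj a') (hsurj a), sum_const, card_univ,
          smul_eq_mul, mul_comm]
    _ = Fintype.card V := (card_eq_sum_card_fiberwise fun _ _ => mem_univ _).symm

end Fibers

section SndProjection

variable (X Y : Type*) [Fintype X] [DecidableEq Y]

/-- The orthogonal projection onto the functions on `X × Y` that depend on the second coordinate
only: it averages over the first one. -/
noncomputable def sndProjection : Matrix (X × Y) (X × Y) ℝ :=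
  .of fun z z' => if z.2 = z'.2 then (Fintype.card X : ℝ)⁻¹ else 0

theorem isStarProjection_sndProjection [Nonempty X] [Fintype Y] :
    IsStarProjection (sndProjection X Y) where
  isIdempotentElem := by
    ext z z'
    by_cases hsnd : z.2 = z'.2 <;>
      simp [sndProjection, Matrix.mul_apply, Fintype.sum_prod_type_right, hsnd]
  isSelfAdjoint := by
    ext z z'
    simp [sndProjection, eq_comm]

end SndProjection

section SumProductMatrix

variable {F V : Type*} [Field F] [DecidableEq F] [AddCommGroup V] [Module F V]

/-- The `0`-`1` matrix of the sum-product relation `x.1 + y.1 + c = B x.2 y.2` on `F × V`. -/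
def sumProductMatrix (B : LinearMap.BilinForm F V) (c : F) : Matrix (F × V) (F × V) ℝ :=
  .of fun x y => if x.1 + y.1 + c = B x.2 y.2 then 1 else 0

theorem sumProductMatrix_mem_Icc (B : LinearMap.BilinForm F V) (c : F) (x y : F × V) :
    sumProductMatrix B c x y ∈ Set.Icc 0 1 := by
  simp only [sumProductMatrix, Matrix.of_apply]
  split_ifs <;> simp

theorem sumProductMatrix_apply_mk (B : LinearMap.BilinForm F V) (c : F) (x : F × V) (a : F)
    (b : V) : sumProductMatrix B c x (a, b) = if a = B x.2 b - x.1 - c then 1 else 0 := by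
  rw [sumProductMatrix, Matrix.of_apply]
  refine if_congr ⟨fun h => ?_, fun h => ?_⟩ rfl rfl <;> linear_combination h

variable [Fintype F] [Fintype V]

theorem sum_sumProductMatrix (B : LinearMap.BilinForm F V) (c : F) (x : F × V) :
    ∑ y, sumProductMatrix B c x y = Fintype.card V := by
  simp [Fintype.sum_prod_type_right, sumProductMatrix_apply_mk]

theorem sum_sumProductMatrix_mul (B : LinearMap.BilinForm F V) (c : F) (x x' : F × V) :
    ∑ y, sumProductMatrix B c x y * sumProductMatrix B c x' y =
      #{b | B (x.2 - x'.2) b = x.1 - x'.1} := by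
  rw [Fintype.sum_prod_type_right, ← sum_boole]
  refine sum_congr rfl fun b _ => ?_
  simp only [sumProductMatrix_apply_mk, boole_mul, sum_ite_eq', mem_univ, if_true]
  refine if_congr ?_ rfl rfl
  rw [map_sub, LinearMap.sub_apply]
  constructor <;> intro h <;> linear_combination h

variable [DecidableEq V]

theorem sumProductMatrix_sub_mul_conjTranspose {B : LinearMap.BilinForm F V}
    (hB : B.SeparatingLeft) (c : F) :
    (sumProductMatrix B c - .of fun _ _ => (Fintype.card F : ℝ)⁻¹) *
        (sumProductMatrix B c - .of fun _ _ => (Fintype.card F : ℝ)⁻¹)ᴴ =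
      (Fintype.card V : ℝ) • (1 - sndProjection F V) := by
  ext x x'
  have hq : (Fintype.card F : ℝ) ≠ 0 := by exact_mod_cast Fintype.card_ne_zero
  have hcodegree : ∑ y, (sumProductMatrix B c x y - (Fintype.card F : ℝ)⁻¹) *
      (sumProductMatrix B c x' y - (Fintype.card F : ℝ)⁻¹) =
      #{b | B (x.2 - x'.2) b = x.1 - x'.1} - Fintype.card V * (Fintype.card F : ℝ)⁻¹ := by
    simp only [sub_mul, mul_sub, sum_sub_distrib, ← mul_sum, ← sum_mul, sum_sumProductMatrix_mul,
      sum_sumProductMatrix, sum_const, card_univ, Fintype.card_prod, nsmul_eq_mul]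
    push_cast
    field_simp
    ring
  simp only [Matrix.mul_apply, Matrix.sub_apply, Matrix.conjTranspose_apply, Matrix.of_apply,
    star_trivial, Matrix.smul_apply, smul_eq_mul, hcodegree, Matrix.one_apply, sndProjection]
  by_cases hsnd : x.2 = x'.2
  · have hfst : x = x' ↔ x.1 - x'.1 = 0 := by simp [Prod.ext_iff, hsnd, sub_eq_zero]
    by_cases hx : x = x' <;> simp [hsnd, hx, ← hfst, eq_comm (a := (0 : F)), mul_sub]
  · have hne : x ≠ x' := fun h => hsnd (congrArg Prod.snd h)
    have hfunctional : B (x.2 - x'.2) ≠ 0 := fun h =>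
      hsnd (sub_eq_zero.1 (hB _ fun w => by rw [h, LinearMap.zero_apply]))
    rw [if_neg hne, if_neg hsnd, ← card_fiber_mul_card_of_ne_zero hfunctional (x.1 - x'.1)]
    push_cast
    field_simp
    ring

theorem l2_opNorm_sumProductMatrix_sub_le {B : LinearMap.BilinForm F V} (hB : B.SeparatingLeft)
    (c : F) :
    ‖sumProductMatrix B c - .of fun _ _ => (Fintype.card F : ℝ)⁻¹‖ ≤ √(Fintype.card V) := by
  refine Real.le_sqrt_of_sq_le ?_
  rw [sq, ← CStarRing.norm_self_mul_star, Matrix.star_eq_conjTranspose,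
    sumProductMatrix_sub_mul_conjTranspose hB, norm_smul, Real.norm_natCast]
  exact mul_le_of_le_one_right (Nat.cast_nonneg _)
    (isStarProjection_sndProjection F V).one_sub.norm_le

end SumProductMatrix

section Decoupling

variable {ι X : Type*} [DecidableEq ι]

theorem apply_update_of_dependsOn {β : Type*} {G : (ι → X) → β} {i : ι} (hG : DependsOn G {i}ᶜ)
    (x : ι → X) (u : X) : G (Function.update x i u) = G x :=
  hG fun _ hk => Function.update_of_ne hk u x

variable [Fintype ι] [Fintype X]

theorem sum_sum_update (G : (ι → X) → ℝ) (i : ι) :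
    ∑ x, ∑ u, G (Function.update x i u) = Fintype.card X * ∑ x, G x := by
  let swap : (ι → X) × X → (ι → X) × X := fun z => (Function.update z.1 i z.2, z.1 i)
  have hswap : Function.Involutive swap := fun z => by simp [swap]
  calc ∑ x, ∑ u, G (Function.update x i u) = ∑ z : (ι → X) × X, G (swap z).1 := by
        rw [Fintype.sum_prod_type]
    _ = ∑ z : (ι → X) × X, G z.1 := Equiv.sum_comp hswap.toPerm fun z => G z.1
    _ = Fintype.card X * ∑ x, G x := by
        simp [Fintype.sum_prod_type, mul_sum]

theorem sum_mul_sum_update {ρ α : (ι → X) → ℝ} {i : ι} (hρ : DependsOn ρ {i}ᶜ) :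
    ∑ x, ρ x * ∑ u, α (Function.update x i u) = Fintype.card X * ∑ x, ρ x * α x := by
  rw [← sum_sum_update (fun x => ρ x * α x) i]
  simp only [mul_sum, apply_update_of_dependsOn hρ]

theorem card_sq_mul_sum_eq_sum_dotProduct_mulVec (A : Matrix X X ℝ) {i j : ι} (hij : i ≠ j)
    {ρ α β : (ι → X) → ℝ} (hρi : DependsOn ρ {i}ᶜ) (hρj : DependsOn ρ {j}ᶜ)
    (hα : DependsOn α {j}ᶜ) (hβ : DependsOn β {i}ᶜ) :
    (Fintype.card X : ℝ) ^ 2 * ∑ x, ρ x * α x * β x * A (x i) (x j) =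
      ∑ x, ρ x * ((fun u => α (Function.update x i u)) ⬝ᵥ
        A *ᵥ fun v => β (Function.update x j v)) := by
  -- Resample the coordinates `i` and `j`: then `α` depends on the new `i` only, `β` on the new `j`.
  set G : (ι → X) → ℝ := fun x => ρ x * α x * β x * A (x i) (x j) with hG
  have hresample (x : ι → X) (u v : X) : G (Function.update (Function.update x i u) j v) =
      ρ x * (α (Function.update x i u) * (A u v * β (Function.update x j v))) := by
    simp only [hG, apply_update_of_dependsOn hρj, apply_update_of_dependsOn hρi,
      apply_update_of_dependsOn hα, Function.update_self, Function.update_of_ne hij]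
    rw [Function.update_comm hij, apply_update_of_dependsOn hβ]
    ring
  rw [sq, mul_assoc, ← sum_sum_update G j,
    ← sum_sum_update (fun x => ∑ v, G (Function.update x j v)) i]
  simp only [hresample, dotProduct, Matrix.mulVec, mul_sum]

theorem card_mul_abs_sum_le_l2_opNorm_mul [DecidableEq X] (A : Matrix X X ℝ) {i j : ι}
    (hij : i ≠ j) {ρ α β : (ι → X) → ℝ} (hρi : DependsOn ρ {i}ᶜ) (hρj : DependsOn ρ {j}ᶜ)
    (hα : DependsOn α {j}ᶜ) (hβ : DependsOn β {i}ᶜ) (hρ0 : ∀ x, 0 ≤ ρ x)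
    (hα01 : ∀ x, α x ∈ Set.Icc 0 1) (hβ01 : ∀ x, β x ∈ Set.Icc 0 1) :
    Fintype.card X * |∑ x, ρ x * α x * β x * A (x i) (x j)| ≤
      ‖A‖ * (√(∑ x, ρ x * α x) * √(∑ x, ρ x * β x)) := by
  rcases isEmpty_or_nonempty X with hX | hX
  · rw [Fintype.card_eq_zero, Nat.cast_zero, zero_mul]
    positivity
  set n : ℝ := (Fintype.card X : ℝ) with hn
  have hn0 : 0 < n := by rw [hn]; exact_mod_cast Fintype.card_pos
  set a : (ι → X) → ℝ := fun x => ∑ u, α (Function.update x i u)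
  set b : (ι → X) → ℝ := fun x => ∑ v, β (Function.update x j v)
  have ha0 (x : ι → X) : 0 ≤ a x := sum_nonneg fun _ _ => (hα01 _).1
  have hb0 (x : ι → X) : 0 ≤ b x := sum_nonneg fun _ _ => (hβ01 _).1
  refine le_of_mul_le_mul_left ?_ hn0
  calc n * (n * |∑ x, ρ x * α x * β x * A (x i) (x j)|)
      = |∑ x, ρ x * ((fun u => α (Function.update x i u)) ⬝ᵥ
          A *ᵥ fun v => β (Function.update x j v))| := by
        rw [← card_sq_mul_sum_eq_sum_dotProduct_mulVec A hij hρi hρj hα hβ, abs_mul,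
          abs_of_nonneg (sq_nonneg n), sq, mul_assoc]
    _ ≤ ∑ x, ‖A‖ * (√(ρ x * a x) * √(ρ x * b x)) :=
        (abs_sum_le_sum_abs _ _).trans (sum_le_sum fun x _ =>
          abs_mul_dotProduct_mulVec_le_of_mem_Icc A (hρ0 x) (fun _ => hα01 _) fun _ => hβ01 _)
    _ ≤ ‖A‖ * (√(∑ x, ρ x * a x) * √(∑ x, ρ x * b x)) := by
        rw [← mul_sum]
        gcongr
        exact Real.sum_sqrt_mul_sqrt_le _ (fun x => mul_nonneg (hρ0 x) (ha0 x))
          fun x => mul_nonneg (hρ0 x) (hb0 x)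
    _ = n * (‖A‖ * (√(∑ x, ρ x * α x) * √(∑ x, ρ x * β x))) := by
        rw [sum_mul_sum_update hρi, sum_mul_sum_update hρj, Real.sqrt_mul hn0.le,
          Real.sqrt_mul hn0.le]
        nth_rewrite 3 [← Real.mul_self_sqrt hn0.le]
        ring

end Decoupling

section IndexPair

variable {t : ℕ}

theorem card_indexPair (t : ℕ) : Fintype.card (IndexPair t) = t.choose 2 := by
  rw [Fintype.card_subtype, Fintype.card_product_filter_lt, Fintype.card_fin]

/-- The pair `p`, seen as an edge of the complete graph on `Fin t`, contains the vertex `k`. -/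
def IndexPair.Incident (p : IndexPair t) (k : Fin t) : Prop := p.1.1 = k ∨ p.1.2 = k

instance (k : Fin t) : DecidablePred (IndexPair.Incident · k) :=
  fun p => inferInstanceAs (Decidable (p.1.1 = k ∨ p.1.2 = k))

theorem IndexPair.eq_of_incident {p e : IndexPair t} (hfst : e.Incident p.1.1)
    (hsnd : e.Incident p.1.2) : e = p := by
  have := p.2
  have := e.2
  unfold IndexPair.Incident at hfst hsnd
  exact Subtype.ext (Prod.ext (by grind) (by grind))

theorem card_filter_incident_lt (H : Finset (IndexPair t)) (k : Fin t) :
    #{p ∈ H | p.Incident k} < t := by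
  have hother : #{p ∈ H | p.Incident k} ≤ #(univ.erase k) := by
    refine card_le_card_of_injOn (fun p => if p.1.1 = k then p.1.2 else p.1.1) ?_ ?_
    · intro p hp
      have := p.2
      simp only [mem_coe, IndexPair.Incident] at hp
      rw [mem_coe, mem_erase]
      grind
    · intro p hp e he hpe
      have := p.2
      have := e.2
      simp only [mem_coe, IndexPair.Incident] at hp he hpe
      exact Subtype.ext (Prod.ext (by grind) (by grind))
  calc #{p ∈ H | p.Incident k} ≤ #(univ.erase k) := hother
    _ < #(univ : Finset (Fin t)) := card_erase_lt_of_mem (mem_univ k)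
    _ = t := card_fin t

theorem prod_erase_eq_mul_prod_filter_incident {M : Type*} [CommMonoid M]
    (H : Finset (IndexPair t)) (p : IndexPair t) (κ : IndexPair t → M) :
    ∏ e ∈ H.erase p, κ e =
      (∏ e ∈ H with ¬ e.Incident p.1.1 ∧ ¬ e.Incident p.1.2, κ e) *
      (∏ e ∈ H with e.Incident p.1.1 ∧ ¬ e.Incident p.1.2, κ e) *
      ∏ e ∈ H with ¬ e.Incident p.1.1 ∧ e.Incident p.1.2, κ e := by
  have hp : p.Incident p.1.1 ∧ p.Incident p.1.2 := ⟨.inl rfl, .inr rfl⟩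
  have hfst : {e ∈ H.erase p | e.Incident p.1.1} =
      {e ∈ H | e.Incident p.1.1 ∧ ¬ e.Incident p.1.2} := by
    ext e
    simp only [mem_filter, mem_erase]
    grind [IndexPair.eq_of_incident]
  have hsnd : {e ∈ H.erase p | ¬ e.Incident p.1.1} = {e ∈ H | ¬ e.Incident p.1.1} := by
    ext e
    simp only [mem_filter, mem_erase]
    grind
  rw [← prod_filter_mul_prod_filter_not (H.erase p) (·.Incident p.1.1), hfst, hsnd,
    ← prod_filter_mul_prod_filter_not {e ∈ H | ¬ e.Incident p.1.1} (·.Incident p.1.2),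
    filter_filter, filter_filter, mul_right_comm]
  ac_rfl

theorem prod_filter_not_incident {M : Type*} [CommMonoid M] (H : Finset (IndexPair t))
    (i j : Fin t) (κ : IndexPair t → M) :
    ∏ e ∈ H with ¬ e.Incident j, κ e =
      (∏ e ∈ H with ¬ e.Incident i ∧ ¬ e.Incident j, κ e) *
      ∏ e ∈ H with e.Incident i ∧ ¬ e.Incident j, κ e := by
  rw [← prod_filter_mul_prod_filter_not {e ∈ H | ¬ e.Incident j} (·.Incident i), filter_filter,
    filter_filter, mul_comm]
  simp only [and_comm]

end IndexPair

section HomCount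

variable {t : ℕ} {X : Type*} {K : IndexPair t → Matrix X X ℝ}

theorem dependsOn_prod_of_not_incident {T : Finset (IndexPair t)} {k : Fin t}
    (hT : ∀ p ∈ T, ¬ p.Incident k) :
    DependsOn (fun x : Fin t → X => ∏ p ∈ T, K p (x p.1.1) (x p.1.2)) {k}ᶜ := by
  intro x y hxy
  refine prod_congr rfl fun p hp => ?_
  rw [hxy _ fun h => hT p hp (.inl h), hxy _ fun h => hT p hp (.inr h)]

variable [Fintype X]

/-- The number of maps from `Fin t` to `X`, each weighted by the product of the entries of `K`
over the images of the edges in `H`. When every `K p` is the adjacency matrix of one graph on `X`,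
this is the number of homomorphisms of `H` to that graph. -/
def homCount (K : IndexPair t → Matrix X X ℝ) (H : Finset (IndexPair t)) : ℝ :=
  ∑ x : Fin t → X, ∏ p ∈ H, K p (x p.1.1) (x p.1.2)

theorem homCount_empty : homCount K ∅ = (Fintype.card X : ℝ) ^ t := by
  simp [homCount]

theorem pow_mul_homCount_filter_not_incident_le {H : Finset (IndexPair t)} {k : Fin t} {c δ : ℝ}
    (hc0 : 0 ≤ c) (hc1 : c ≤ 1) (hδ : δ ≤ 1)
    (hcount : |homCount K {e ∈ H | ¬ e.Incident k} -
        c ^ #{e ∈ H | ¬ e.Incident k} * (Fintype.card X : ℝ) ^ t| ≤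
      δ * (c ^ #{e ∈ H | ¬ e.Incident k} * (Fintype.card X : ℝ) ^ t)) :
    c ^ t * homCount K {e ∈ H | ¬ e.Incident k} ≤
      2 * (c ^ (#H + 1) * (Fintype.card X : ℝ) ^ t) := by
  set T := {e ∈ H | ¬ e.Incident k}
  have hexponent : #H + 1 ≤ t + #T := by
    have hsplit : #{e ∈ H | e.Incident k} + #T = #H :=
      card_filter_add_card_filter_not (IndexPair.Incident · k)
    have := card_filter_incident_lt H k
    omega
  have htwice : homCount K T ≤ 2 * (c ^ #T * (Fintype.card X : ℝ) ^ t) := by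
    have hδT : δ * (c ^ #T * (Fintype.card X : ℝ) ^ t) ≤ c ^ #T * (Fintype.card X : ℝ) ^ t :=
      mul_le_of_le_one_left (by positivity) hδ
    linarith [(abs_le.1 hcount).2]
  calc c ^ t * homCount K T ≤ c ^ t * (2 * (c ^ #T * (Fintype.card X : ℝ) ^ t)) := by gcongr
    _ = 2 * (c ^ (t + #T) * (Fintype.card X : ℝ) ^ t) := by ring
    _ ≤ _ := by
        gcongr 2 * (?_ * _)
        exact pow_le_pow_of_le_one hc0 hc1 hexponent

variable [DecidableEq X]

theorem card_mul_abs_homCount_sub_mul_homCount_erase_le (hK : ∀ p x y, K p x y ∈ Set.Icc 0 1)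
    {H : Finset (IndexPair t)} {p : IndexPair t} (hp : p ∈ H) (c : ℝ) :
    Fintype.card X * |homCount K H - c * homCount K (H.erase p)| ≤
      ‖K p - .of fun _ _ => c‖ * (√(homCount K {e ∈ H | ¬ e.Incident p.1.2}) *
        √(homCount K {e ∈ H | ¬ e.Incident p.1.1})) := by
  set κ : (Fin t → X) → IndexPair t → ℝ := fun x e => K e (x e.1.1) (x e.1.2)
  have hdiff : homCount K H - c * homCount K (H.erase p) =
      ∑ x, (∏ e ∈ H with ¬ e.Incident p.1.1 ∧ ¬ e.Incident p.1.2, κ x e) *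
        (∏ e ∈ H with e.Incident p.1.1 ∧ ¬ e.Incident p.1.2, κ x e) *
        (∏ e ∈ H with ¬ e.Incident p.1.1 ∧ e.Incident p.1.2, κ x e) *
        (K p - .of fun _ _ => c) (x p.1.1) (x p.1.2) := by
    rw [homCount, homCount, mul_sum, ← sum_sub_distrib]
    refine sum_congr rfl fun x _ => ?_
    rw [← prod_erase_eq_mul_prod_filter_incident, ← mul_prod_erase H _ hp, Matrix.sub_apply,
      Matrix.of_apply]
    ring
  have hsnd : homCount K {e ∈ H | ¬ e.Incident p.1.2} =
      ∑ x, (∏ e ∈ H with ¬ e.Incident p.1.1 ∧ ¬ e.Incident p.1.2, κ x e) *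
        ∏ e ∈ H with e.Incident p.1.1 ∧ ¬ e.Incident p.1.2, κ x e :=
    sum_congr rfl fun x _ => prod_filter_not_incident H p.1.1 p.1.2 (κ x)
  have hfst : homCount K {e ∈ H | ¬ e.Incident p.1.1} =
      ∑ x, (∏ e ∈ H with ¬ e.Incident p.1.1 ∧ ¬ e.Incident p.1.2, κ x e) *
        ∏ e ∈ H with ¬ e.Incident p.1.1 ∧ e.Incident p.1.2, κ x e := by
    simp only [and_comm (a := ¬ IndexPair.Incident _ p.1.1)]
    exact sum_congr rfl fun x _ => prod_filter_not_incident H p.1.2 p.1.1 (κ x)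
  rw [hdiff, hsnd, hfst]
  exact card_mul_abs_sum_le_l2_opNorm_mul _ p.2.ne
    (dependsOn_prod_of_not_incident fun e he => (mem_filter.1 he).2.1)
    (dependsOn_prod_of_not_incident fun e he => (mem_filter.1 he).2.2)
    (dependsOn_prod_of_not_incident fun e he => (mem_filter.1 he).2.2)
    (dependsOn_prod_of_not_incident fun e he => (mem_filter.1 he).2.1)
    (fun x => (unitInterval.prod_mem fun e _ => hK e _ _).1)
    (fun x => unitInterval.prod_mem fun e _ => hK e _ _)
    (fun x => unitInterval.prod_mem fun e _ => hK e _ _)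

theorem abs_homCount_sub_mul_homCount_erase_le [Nonempty X]
    (hK : ∀ p x y, K p x y ∈ Set.Icc 0 1) {H : Finset (IndexPair t)} {p : IndexPair t}
    (hp : p ∈ H) {c θ η w : ℝ} (hc : 0 < c) (hθ : ‖K p - .of fun _ _ => c‖ ≤ θ)
    (hη : θ * c ≤ η * (c ^ t * Fintype.card X))
    (hw : ∀ k, p.Incident k → c ^ t * homCount K {e ∈ H | ¬ e.Incident k} ≤ c * w) :
    |homCount K H - c * homCount K (H.erase p)| ≤ η * w := by
  set n : ℝ := (Fintype.card X : ℝ) with hn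
  have hn0 : 0 < n := by rw [hn]; exact_mod_cast Fintype.card_pos
  have hθ0 : 0 ≤ θ := (norm_nonneg _).trans hθ
  have hbound (k) (hk : p.Incident k) : homCount K {e ∈ H | ¬ e.Incident k} ≤ c * w / c ^ t := by
    rw [le_div_iff₀' (by positivity)]
    exact hw k hk
  have hcount0 : 0 ≤ homCount K {e ∈ H | ¬ e.Incident p.1.1} :=
    sum_nonneg fun x _ => (unitInterval.prod_mem fun e _ => hK e _ _).1
  have hw0 : 0 ≤ w := (mul_nonneg_iff_of_pos_left hc).1
    ((mul_nonneg (by positivity) hcount0).trans (hw _ (.inl rfl)))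
  refine le_of_mul_le_mul_left ?_ hn0
  calc n * |homCount K H - c * homCount K (H.erase p)|
      ≤ ‖K p - .of fun _ _ => c‖ * (√(homCount K {e ∈ H | ¬ e.Incident p.1.2}) *
          √(homCount K {e ∈ H | ¬ e.Incident p.1.1})) :=
        card_mul_abs_homCount_sub_mul_homCount_erase_le hK hp c
    _ ≤ θ * (√(c * w / c ^ t) * √(c * w / c ^ t)) := by
        gcongr
        · exact hbound _ (.inr rfl)
        · exact hbound _ (.inl rfl)
    _ = θ * c / c ^ t * w := by rw [Real.mul_self_sqrt (by positivity)]; ring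
    _ ≤ η * n * w := by
        gcongr
        rw [div_le_iff₀ (by positivity)]
        linarith
    _ = n * (η * w) := by ring

theorem abs_homCount_sub_le [Nonempty X] (hK : ∀ p x y, K p x y ∈ Set.Icc 0 1) {c θ η : ℝ}
    (hc0 : 0 < c) (hc1 : c ≤ 1) (hθ : ∀ p, ‖K p - .of fun _ _ => c‖ ≤ θ) (hη0 : 0 ≤ η)
    (hη : θ * c ≤ η * (c ^ t * Fintype.card X)) (H : Finset (IndexPair t))
    (hH : 2 * #H * η ≤ 1) :
    |homCount K H - c ^ #H * (Fintype.card X : ℝ) ^ t| ≤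
      2 * #H * η * (c ^ #H * (Fintype.card X : ℝ) ^ t) := by
  induction H using Finset.strongInduction with
  | H H ih =>
  rcases H.eq_empty_or_nonempty with rfl | ⟨p, hp⟩
  · simp [homCount_empty]
  have hsmall {T : Finset (IndexPair t)} (hT : T ⊂ H) : 2 * #T * η ≤ 1 := by
    refine le_trans ?_ hH
    gcongr
  have hnotIncident (k) (hk : p.Incident k) :
      c ^ t * homCount K {e ∈ H | ¬ e.Incident k} ≤
        c * (2 * (c ^ #H * (Fintype.card X : ℝ) ^ t)) := by
    have hT : {e ∈ H | ¬ e.Incident k} ⊂ H := filter_ssubset.2 ⟨p, hp, not_not.2 hk⟩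
    refine (pow_mul_homCount_filter_not_incident_le hc0.le hc1 (hsmall hT)
      (ih _ hT (hsmall hT))).trans_eq ?_
    ring
  have hremove := abs_homCount_sub_mul_homCount_erase_le hK hp hc0 (hθ p) hη hnotIncident
  have herase := ih _ (erase_ssubset hp) (hsmall (erase_ssubset hp))
  have hcard : #H = #(H.erase p) + 1 := (card_erase_add_one hp).symm
  set N : ℝ := c ^ #(H.erase p) * (Fintype.card X : ℝ) ^ t with hN
  have hcN : c ^ #H * (Fintype.card X : ℝ) ^ t = c * N := by rw [hN, hcard]; ring
  rw [hcN] at hremove ⊢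
  calc |homCount K H - c * N|
      ≤ |homCount K H - c * homCount K (H.erase p)| + |c * homCount K (H.erase p) - c * N| :=
        abs_sub_le _ _ _
    _ ≤ η * (2 * (c * N)) + c * (2 * #(H.erase p) * η * N) := by
        rw [← mul_sub, abs_mul, abs_of_pos hc0]
        gcongr
    _ = 2 * #H * η * (c * N) := by rw [hcard]; push_cast; ring

end HomCount

section SystemParameter

variable {F V : Type*} [Field F] [AddCommGroup V] [Module F V] {t : ℕ}

/-- The parameters `lam` for which the tuple `x` solves the system
`(x i).1 + (x j).1 + lam (i, j) = B (x i).2 (x j).2`, `i < j`. -/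
def systemParameter (B : LinearMap.BilinForm F V) (x : Fin t → F × V) : IndexPair t → F :=
  fun p => B (x p.1.1).2 (x p.1.2).2 - (x p.1.1).1 - (x p.1.2).1

theorem systemParameter_eq_iff {B : LinearMap.BilinForm F V} {x : Fin t → F × V}
    {lam : IndexPair t → F} : systemParameter B x = lam ↔
      ∀ p : IndexPair t, (x p.1.1).1 + (x p.1.2).1 + lam p = B (x p.1.1).2 (x p.1.2).2 := by
  rw [funext_iff]
  refine forall_congr' fun p => ?_
  simp only [systemParameter]
  constructor <;> intro h <;> linear_combination -h

variable [DecidableEq F] {X : Type*} [Fintype X]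

theorem homCount_submatrix_sumProductMatrix (B : LinearMap.BilinForm F V) (φ : X → F × V)
    (lam : IndexPair t → F) :
    homCount (fun p => (sumProductMatrix B (lam p)).submatrix φ φ) univ =
      #{x : Fin t → X | systemParameter B (φ ∘ x) = lam} := by
  simp only [homCount, sumProductMatrix, Matrix.submatrix_apply, Matrix.of_apply, prod_boole,
    sum_boole, systemParameter_eq_iff, mem_univ, true_imp_iff, Function.comp_apply]

theorem abs_card_systemParameter_eq_sub_le [Fintype F] [Fintype V] [DecidableEq V] [Nonempty X]
    {B : LinearMap.BilinForm F V} (hB : B.SeparatingLeft) {φ : X → F × V} {r : ℕ}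
    (hr : ∀ y, #{x | φ x = y} ≤ r) {η : ℝ} (hη0 : 0 ≤ η) (hη1 : 2 * t.choose 2 * η ≤ 1)
    (hη : r * √(Fintype.card V) * (Fintype.card F : ℝ) ^ t ≤
      η * (Fintype.card F * Fintype.card X)) (lam : IndexPair t → F) :
    |#{x : Fin t → X | systemParameter B (φ ∘ x) = lam} -
        (Fintype.card X : ℝ) ^ t / (Fintype.card F : ℝ) ^ t.choose 2| ≤
      2 * t.choose 2 * η * ((Fintype.card X : ℝ) ^ t / (Fintype.card F : ℝ) ^ t.choose 2) := by
  classical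
  have hq : (1 : ℝ) ≤ Fintype.card F := by exact_mod_cast Fintype.card_pos
  set K : IndexPair t → Matrix X X ℝ := fun p => (sumProductMatrix B (lam p)).submatrix φ φ with hK
  have hnorm (p : IndexPair t) :
      ‖K p - .of fun _ _ => (Fintype.card F : ℝ)⁻¹‖ ≤ r * √(Fintype.card V) := by
    have hsubmatrix : K p - .of (fun _ _ => (Fintype.card F : ℝ)⁻¹) =
        (sumProductMatrix B (lam p) - .of fun _ _ => (Fintype.card F : ℝ)⁻¹).submatrix φ φ := rfl
    rw [hsubmatrix]
    exact (l2_opNorm_submatrix_le _ φ hr).trans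
      (mul_le_mul_of_nonneg_left (l2_opNorm_sumProductMatrix_sub_le hB (lam p)) r.cast_nonneg)
  have hcount := abs_homCount_sub_le (K := K)
    (fun p x y => sumProductMatrix_mem_Icc B (lam p) (φ x) (φ y)) (by positivity)
    (inv_le_one_of_one_le₀ hq) hnorm hη0
    (by
      rw [inv_pow]
      field_simp
      linarith) univ (by rwa [card_univ, card_indexPair])
  rwa [hK, homCount_submatrix_sumProductMatrix, card_univ, card_indexPair, inv_pow, inv_mul_eq_div]
    at hcount

end SystemParameter

section Collisions

theorem card_sq_le_card_image_mul_card_collisions {α β : Type*} [DecidableEq β]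
    (s : Finset α) (f : α → β) :
    #s ^ 2 ≤ #(s.image f) * #{z ∈ s ×ˢ s | f z.1 = f z.2} := by
  have hfibers : #s = ∑ c ∈ s.image f, #{x ∈ s | f x = c} :=
    card_eq_sum_card_fiberwise fun _ => mem_image_of_mem _
  have hcollisions : #{z ∈ s ×ˢ s | f z.1 = f z.2} = ∑ c ∈ s.image f, #{x ∈ s | f x = c} ^ 2 := by
    rw [card_eq_sum_card_fiberwise (f := fun z : α × α => f z.1) (t := s.image f)]
    · refine sum_congr rfl fun c _ => ?_
      rw [sq, ← card_product]
      congr 1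
      ext z
      simp only [mem_filter, mem_product]
      grind
    · intro z hz
      simp only [coe_filter, mem_product] at hz
      exact mem_coe.2 (mem_image_of_mem _ hz.1.1)
  rw [hcollisions, hfibers]
  exact sq_sum_le_card_mul_sum_sq

/-- Two points of `F × V` encoded as one point of `F × (V × V)`. Subtracting two equations
`x.1 + y.1 + c = B x.2 y.2` with the same `c` leaves a relation between these encodings. -/
def pairDifference {F V : Type*} [Sub F] (z : (F × V) × (F × V)) : F × (V × V) :=
  (z.1.1 - z.2.1, (z.1.2, z.2.2))

theorem card_fiber_pairDifference_le {F V X : Type*} [AddGroup F] [Fintype F] [DecidableEq F]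
    [DecidableEq V] [Fintype X] {ψ : X → F × V} (hψ : ψ.Injective) (y : F × (V × V)) :
    #{z | pairDifference (Prod.map ψ ψ z) = y} ≤ Fintype.card F := by
  rw [← card_univ]
  refine card_le_card_of_injOn (fun z => (ψ z.2).1) (fun _ _ => mem_coe.2 (mem_univ _)) ?_
  intro z hz z' hz' hzz'
  have heq := (mem_filter.1 hz).2.trans (mem_filter.1 hz').2.symm
  simp only [pairDifference, Prod.map_fst, Prod.map_snd, Prod.mk.injEq] at heq hzz'
  obtain ⟨hsub, hfst, hsnd⟩ := heq
  rw [hzz', sub_left_inj] at hsub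
  exact Prod.ext (hψ (Prod.ext hsub hfst)) (hψ (Prod.ext hzz' hsnd))

variable {F V : Type*} [Field F] [AddCommGroup V] [Module F V]

/-- The form `B v.1 w.1 - B v.2 w.2` on `V × V`: pairs of tuples with the same `systemParameter B`
are the solutions of the system of `differenceForm B` with all parameters `0`. -/
def differenceForm (B : LinearMap.BilinForm F V) : LinearMap.BilinForm F (V × V) :=
  B.compl₁₂ (LinearMap.fst F V V) (LinearMap.fst F V V) -
    B.compl₁₂ (LinearMap.snd F V V) (LinearMap.snd F V V)

theorem differenceForm_apply (B : LinearMap.BilinForm F V) (v w : V × V) :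
    differenceForm B v w = B v.1 w.1 - B v.2 w.2 := rfl

theorem separatingLeft_differenceForm {B : LinearMap.BilinForm F V} (hB : B.SeparatingLeft) :
    (differenceForm B).SeparatingLeft := by
  refine fun v h => Prod.ext (hB _ fun w => ?_) (hB _ fun w => ?_)
  · simpa [differenceForm_apply] using h (w, 0)
  · simpa [differenceForm_apply] using h (0, w)

theorem systemParameter_differenceForm {t : ℕ} (B : LinearMap.BilinForm F V)
    (x : Fin t → (F × V) × (F × V)) :
    systemParameter (differenceForm B) (pairDifference ∘ x) =
      systemParameter B (Prod.fst ∘ x) - systemParameter B (Prod.snd ∘ x) := by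
  ext p
  simp only [systemParameter, differenceForm_apply, pairDifference, Function.comp_apply,
    Pi.sub_apply]
  ring

variable {X : Type*} [Fintype X] {ψ : X → F × V} [DecidableEq F]

theorem card_collisions_eq (B : LinearMap.BilinForm F V) (ψ : X → F × V) (t : ℕ) :
    #{z : (Fin t → X) × (Fin t → X) |
        systemParameter B (ψ ∘ z.1) = systemParameter B (ψ ∘ z.2)} =
      #{x : Fin t → X × X |
        systemParameter (differenceForm B) (pairDifference ∘ Prod.map ψ ψ ∘ x) = 0} := by
  refine card_equiv (Equiv.arrowProdEquivProdArrow _ _ _).symm fun z => ?_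
  simp only [mem_filter, mem_univ, true_and, systemParameter_differenceForm, sub_eq_zero]
  rfl

variable [Fintype F]

theorem card_collisions_le [Fintype V] [Nonempty X] {t : ℕ} {B : LinearMap.BilinForm F V}
    (hB : B.SeparatingLeft) (hψ : ψ.Injective) {η : ℝ} (hη0 : 0 ≤ η)
    (hη1 : 2 * t.choose 2 * η ≤ 1)
    (hη : Fintype.card V * (Fintype.card F : ℝ) ^ t ≤ η * (Fintype.card X : ℝ) ^ 2) :
    (#{z : (Fin t → X) × (Fin t → X) |
        systemParameter B (ψ ∘ z.1) = systemParameter B (ψ ∘ z.2)} : ℝ) ≤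
      (1 + 2 * t.choose 2 * η) *
        (((Fintype.card X : ℝ) ^ t) ^ 2 / (Fintype.card F : ℝ) ^ t.choose 2) := by
  classical
  have hcount := abs_card_systemParameter_eq_sub_le (t := t) (separatingLeft_differenceForm hB)
    (φ := pairDifference ∘ Prod.map ψ ψ) (card_fiber_pairDifference_le hψ) hη0 hη1 (by
      rw [Fintype.card_prod, Fintype.card_prod, Nat.cast_mul, Nat.cast_mul,
        Real.sqrt_mul_self (Nat.cast_nonneg _)]
      calc _ = Fintype.card F * (Fintype.card V * (Fintype.card F : ℝ) ^ t) := by ring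
        _ ≤ Fintype.card F * (η * (Fintype.card X : ℝ) ^ 2) := by gcongr
        _ = _ := by ring) 0
  rw [Fintype.card_prod, Nat.cast_mul, ← sq, pow_right_comm] at hcount
  rw [card_collisions_eq]
  simp only [Function.comp_assoc] at hcount
  linarith [(abs_le.1 hcount).2]

theorem card_image_systemParameter_ge [Fintype V] [Nonempty X] {t : ℕ}
    {B : LinearMap.BilinForm F V} (hB : B.SeparatingLeft) (hψ : ψ.Injective) {η : ℝ}
    (hη0 : 0 ≤ η) (hη1 : 2 * t.choose 2 * η ≤ 1)
    (hη : Fintype.card V * (Fintype.card F : ℝ) ^ t ≤ η * (Fintype.card X : ℝ) ^ 2) :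
    (1 - 2 * t.choose 2 * η) * (Fintype.card F : ℝ) ^ t.choose 2 ≤
      #(univ.image fun x : Fin t → X => systemParameter B (ψ ∘ x)) := by
  set I : ℝ := (#(univ.image fun x : Fin t → X => systemParameter B (ψ ∘ x)) : ℝ) with hI
  set Q : ℝ := (Fintype.card F : ℝ) ^ t.choose 2 with hQ
  set W : ℝ := ((Fintype.card X : ℝ) ^ t) ^ 2 with hW
  set δ : ℝ := 2 * t.choose 2 * η with hδ
  have hQ0 : 0 < Q := by rw [hQ]; have := Fintype.card_pos (α := F); positivity
  have hW0 : 0 < W := by rw [hW]; have := Fintype.card_pos (α := X); positivity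
  have hcauchySchwarz : W ≤ I * #{z : (Fin t → X) × (Fin t → X) |
      systemParameter B (ψ ∘ z.1) = systemParameter B (ψ ∘ z.2)} := by
    have := card_sq_le_card_image_mul_card_collisions (univ : Finset (Fin t → X))
      fun x => systemParameter B (ψ ∘ x)
    rw [card_univ, Fintype.card_pi_const, univ_product_univ] at this
    rw [hW, hI]
    exact_mod_cast this
  have hupper : Q ≤ I * (1 + δ) := by
    refine le_of_mul_le_mul_left ?_ hW0
    calc W * Q ≤ I * ((1 + δ) * (W / Q)) * Q := by
          gcongr
          exact hcauchySchwarz.trans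
            (mul_le_mul_of_nonneg_left (card_collisions_le hB hψ hη0 hη1 hη) (Nat.cast_nonneg _))
      _ = W * (I * (1 + δ)) := by field_simp
  calc (1 - δ) * Q ≤ (1 - δ) * (I * (1 + δ)) :=
        mul_le_mul_of_nonneg_left hupper (by linarith)
    _ = I - I * δ ^ 2 := by ring
    _ ≤ I := sub_le_self _ (by positivity)

end Collisions

section SumProductSystem

theorem nonempty_of_pos_of_le_mul_card {α : Type*} {s : Finset α} {a c : ℝ} (ha : 0 < a)
    (h : a ≤ c * #s) : s.Nonempty := by
  rw [nonempty_iff_ne_empty]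
  rintro rfl
  rw [card_empty, Nat.cast_zero, mul_zero] at h
  exact ha.not_ge h

variable {F : Type*} [Field F] {d t : ℕ} {B : LinearMap.BilinForm F (Fin d → F)}
  {E : Finset (F × (Fin d → F))}

theorem mem_sumProductSolutions_iff {lam : IndexPair t → F} {x : Fin t → F × (Fin d → F)} :
    x ∈ sumProductSolutions B E lam ↔ (∀ i, x i ∈ E) ∧ systemParameter B x = lam := by
  rw [systemParameter_eq_iff]
  rfl

theorem mem_solvableParameters_iff {lam : IndexPair t → F} :
    lam ∈ solvableParameters t B E ↔
      ∃ x : Fin t → E, systemParameter B (Subtype.val ∘ x) = lam := by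
  constructor
  · rintro ⟨x, hx⟩
    obtain ⟨hE, hlam⟩ := mem_sumProductSolutions_iff.1 hx
    exact ⟨fun i => ⟨x i, hE i⟩, hlam⟩
  · rintro ⟨x, hx⟩
    exact ⟨_, mem_sumProductSolutions_iff.2 ⟨fun i => (x i).2, hx⟩⟩

theorem ncard_sumProductSolutions [DecidableEq F] (lam : IndexPair t → F) :
    (sumProductSolutions B E lam).ncard =
      #{x : Fin t → E | systemParameter B (Subtype.val ∘ x) = lam} := by
  have himage : sumProductSolutions B E lam = (Subtype.val ∘ ·) ''
      {x : Fin t → E | systemParameter B (Subtype.val ∘ x) = lam} := by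
    ext x
    rw [mem_sumProductSolutions_iff]
    constructor
    · rintro ⟨hE, hlam⟩
      exact ⟨fun i => ⟨x i, hE i⟩, hlam, rfl⟩
    · rintro ⟨y, hy, rfl⟩
      exact ⟨fun i => (y i).2, hy⟩
  rw [himage, Set.ncard_image_of_injective _ Subtype.val_injective.comp_left,
    ← Set.ncard_coe_finset, coe_filter_univ]

variable [Fintype F]

theorem abs_ncard_sumProductSolutions_sub_le (hB : B.SeparatingLeft) {η : ℝ} (hη0 : 0 ≤ η)
    (hη1 : 2 * t.choose 2 * η ≤ 1)
    (hE : (Fintype.card F : ℝ) ^ ((d : ℝ) / 2 + t - 1) ≤ η * #E) (lam : IndexPair t → F) :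
    |(sumProductSolutions B E lam).ncard -
        (#E : ℝ) ^ t / (Fintype.card F : ℝ) ^ t.choose 2| ≤
      2 * t.choose 2 * η * ((#E : ℝ) ^ t / (Fintype.card F : ℝ) ^ t.choose 2) := by
  classical
  have hq : (0 : ℝ) < Fintype.card F := by exact_mod_cast Fintype.card_pos
  have hEne : Nonempty E :=
    (nonempty_of_pos_of_le_mul_card (Real.rpow_pos_of_pos hq _) hE).to_subtype
  have hpow : √(Fintype.card (Fin d → F)) * (Fintype.card F : ℝ) ^ t =
      Fintype.card F * (Fintype.card F : ℝ) ^ ((d : ℝ) / 2 + t - 1) := by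
    rw [Fintype.card_pi_const, Nat.cast_pow, Real.sqrt_eq_rpow, ← Real.rpow_natCast,
      ← Real.rpow_natCast, ← Real.rpow_mul hq.le, ← Real.rpow_add hq,
      mul_comm (Fintype.card F : ℝ), ← Real.rpow_add_one hq.ne']
    congr 1
    ring
  have hcount := abs_card_systemParameter_eq_sub_le hB (φ := (Subtype.val : E → _)) (r := 1)
    (fun y => card_le_one.2 fun x hx x' hx' =>
      Subtype.ext ((mem_filter.1 hx).2.trans (mem_filter.1 hx').2.symm)) hη0 hη1
    (by
      rw [Nat.cast_one, one_mul, hpow, mul_left_comm, Fintype.card_coe]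
      gcongr) lam
  rwa [Fintype.card_coe, ← ncard_sumProductSolutions] at hcount

theorem ncard_solvableParameters_ge (hB : B.SeparatingLeft) {η : ℝ} (hη0 : 0 ≤ η)
    (hη1 : 2 * t.choose 2 * η ≤ 1)
    (hE : (Fintype.card F : ℝ) ^ (((d : ℝ) + t) / 2) ≤ √η * #E) :
    (1 - 2 * t.choose 2 * η) * (Fintype.card F : ℝ) ^ t.choose 2 ≤
      (solvableParameters t B E).ncard := by
  classical
  have hq : (0 : ℝ) < Fintype.card F := by exact_mod_cast Fintype.card_pos
  have hEne : Nonempty E :=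
    (nonempty_of_pos_of_le_mul_card (Real.rpow_pos_of_pos hq _) hE).to_subtype
  have hpow : Fintype.card (Fin d → F) * (Fintype.card F : ℝ) ^ t =
      ((Fintype.card F : ℝ) ^ (((d : ℝ) + t) / 2)) ^ 2 := by
    rw [← Real.rpow_mul_natCast hq.le, Nat.cast_two,
      div_mul_cancel₀ _ two_ne_zero, ← Nat.cast_add, Real.rpow_natCast, pow_add,
      Fintype.card_pi_const, Nat.cast_pow]
  have himage : solvableParameters t B E =
      univ.image fun x : Fin t → E => systemParameter B (Subtype.val ∘ x) := by
    ext lam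
    simp [mem_solvableParameters_iff]
  rw [himage, Set.ncard_coe_finset]
  refine card_image_systemParameter_ge hB Subtype.val_injective hη0 hη1 ?_
  rw [hpow, Fintype.card_coe]
  calc _ ≤ (√η * #E) ^ 2 := by gcongr
    _ = η * (#E : ℝ) ^ 2 := by rw [mul_pow, Real.sq_sqrt hη0]

end SumProductSystem

theorem mainTheorem12 (t : ℕ) (ε : ℝ) (hε : 0 < ε) :
    ∃ C : ℝ, 0 < C ∧
      ∀ (F : Type*) [Field F] [Fintype F] (d : ℕ)
        (B : LinearMap.BilinForm F (Fin d → F)) (_ : B.Nondegenerate)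
        (E : Finset (F × (Fin d → F))),
        (C * (Fintype.card F : ℝ) ^ ((d : ℝ) / 2 + (t : ℝ) - 1) ≤ (E.card : ℝ) →
          ∀ lam : IndexPair t → F,
            |((sumProductSolutions B E lam).ncard : ℝ)
                - (E.card : ℝ) ^ t / (Fintype.card F : ℝ) ^ (t.choose 2)|
              ≤ ε * ((E.card : ℝ) ^ t / (Fintype.card F : ℝ) ^ (t.choose 2))) ∧
        (C * (Fintype.card F : ℝ) ^ (((d : ℝ) + (t : ℝ)) / 2) ≤ (E.card : ℝ) →
          (1 - ε) * (Fintype.card F : ℝ) ^ (t.choose 2)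
            ≤ ((solvableParameters t B E).ncard : ℝ)) := by
  set η : ℝ := min ε 1 / (2 * t.choose 2 + 1) with hηdef
  have hη : 0 < η := by positivity
  have hηmul : 2 * t.choose 2 * η + η = min ε 1 := by rw [hηdef]; field_simp
  have hδ : 0 ≤ 2 * t.choose 2 * η := by positivity
  have hδε : 2 * t.choose 2 * η ≤ ε := by linarith [min_le_left ε 1]
  have hδ1 : 2 * t.choose 2 * η ≤ 1 := by linarith [min_le_right ε 1]
  have hη1 : η ≤ 1 := by linarith [min_le_right ε 1]
  have hηsqrt : η ≤ √η := Real.le_sqrt_of_sq_le (pow_le_of_le_one hη.le hη1 two_ne_zero)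
  refine ⟨η⁻¹, inv_pos.2 hη, fun F _ _ d B hB E => ⟨fun hE lam => ?_, fun hE => ?_⟩⟩
  · refine (abs_ncard_sumProductSolutions_sub_le hB.1 hη.le hδ1
      ((inv_mul_le_iff₀ hη).1 hE) lam).trans ?_
    gcongr
  · have hE' := ((inv_mul_le_iff₀ hη).1 hE).trans
      (mul_le_mul_of_nonneg_right hηsqrt (Nat.cast_nonneg _))
    refine le_trans ?_ (ncard_solvableParameters_ge hB.1 hη.le hδ1 hE')
    gcongr
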